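/- \textbf{Lemma (Ellipsoidal covering of the Grassmannian manifold).} For integers $0\le r\le d$ let $\mathrm{Gr}(d,r)$ be the set of $r$-dimensional linear subspaces of $\mathbb{R}^d$, and let $\mu=\mathrm{Unif}(\mathrm{Gr}(d,r))$ be the rotation invariant Borel probability measure on it, that is, the law of $U\mathcal{V}_0$ for a Haar distributed $U\in O(d)$ and a fixed $\mathcal{V}_0\in\mathrm{Gr}(d,r)$. For $\mathcal{V}\in\mathrm{Gr}(d,r)$ let $\mathcal{P}_{\mathcal{V}}$ be the orthogonal projector onto $\mathcal{V}$. For a positive semidefinite matrix $\Sigma\in\mathbb{R}^{d\times d}$ put $$\varrho_{\mathrm{proj},\Sigma}(\mathcal{V},\bar{\mathcal{V}})=\bigl\|\Sigma^{1/2}(\mathcal{P}_{\mathcal{V}}-\mathcal{P}_{\bar{\mathcal{V}}})\bigr\|_{\mathrm{op}},\qquad B_{\varrho_{\mathrm{proj},\Sigma}}(\mathcal{V},\varepsilon)=\{\bar{\mathcal{V}}\in\mathrm{Gr}(d,r):\varrho_{\mathrm{proj},\Sigma}(\mathcal{V},\bar{\mathcal{V}})\le\varepsilon\}.$$ There is an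 absolute constant $C>0$ such that for all integers $0\le r\le d$, every $\mathcal{V}\in\mathrm{Gr}(d,r)$, every $\varepsilon>0$ and every positive semidefinite $\Sigma\in\mathbb{R}^{d\times d}$ with eigenvalues $\lambda_1\ge\cdots\ge\lambda_d\ge 0$ (counted with multiplicity), the ball $B_{\varrho_{\mathrm{proj},\Sigma}}(\mathcal{V},\varepsilon)$ has positive measure and $$\log\frac{1}{\mu\bigl(B_{\varrho_{\mathrm{proj},\Sigma}}(\mathcal{V},\varepsilon)\bigr)}\le\frac{d-r}{2}\sum_{k=1}^{r}\log\frac{C\max\{\lambda_k,\varepsilon^2\}}{\varepsilon^2}+\frac{r}{2}\sum_{k=1}^{d-r}\log\frac{C\max\{\lambda_k,\varepsilon^2\}}{\varepsilon^2}.$$ -/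

import Mathlib

noncomputable section

open scoped MatrixOrder

namespace GrassmannCover

/-- Euclidean space `ℝ^d`, with the `ℓ²` norm and inner product. -/
abbrev Euc (d : ℕ) : Type := EuclideanSpace ℝ (Fin d)

/-- `Gr(d, r)`: the `r`-dimensional linear subspaces of `ℝ^d`. -/
def Gr (d r : ℕ) : Type := {V : Submodule ℝ (Euc d) // Module.finrank ℝ V = r}

/-- The orthogonal projector onto the subspace `V`. -/
def proj {d r : ℕ} (V : Gr d r) : Euc d →L[ℝ] Euc d := V.1.starProjection

/-- The Borel `σ`-algebra of `Gr(d, r)`, embedded in the space of linear operators through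
`V ↦ P_V` (this is the embedding that induces the usual topology of the Grassmannian). -/
instance (d r : ℕ) : MeasurableSpace (Gr d r) :=
  MeasurableSpace.comap (proj (d := d) (r := r)) inferInstance

/-- The orthogonal group `O(d)`: operators `U` on `ℝ^d` with `Uᵀ U = U Uᵀ = 1`, with the topology
of the operator norm. -/
abbrev OGroup (d : ℕ) : Type := unitary (Euc d →L[ℝ] Euc d)

instance (d : ℕ) : ContinuousStar (Euc d →L[ℝ] Euc d) :=
  ⟨(ContinuousLinearMap.adjoint (𝕜 := ℝ) (E := Euc d) (F := Euc d)).continuous⟩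

instance (d : ℕ) : CompactSpace (OGroup d) := by
  apply isCompact_iff_compactSpace.mp
  apply Metric.isCompact_of_isClosed_isBounded
  · have h : ((unitary (Euc d →L[ℝ] Euc d) : Submonoid _) : Set (Euc d →L[ℝ] Euc d)) =
        {U | star U * U = 1} ∩ {U | U * star U = 1} := by
      ext U
      exact Unitary.mem_iff
    rw [h]
    exact (isClosed_eq (by fun_prop) continuous_const).inter
      (isClosed_eq (by fun_prop) continuous_const)
  · refine (Metric.isBounded_closedBall (x := (0 : Euc d →L[ℝ] Euc d)) (r := 1)).subset ?_
    intro U hU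
    rw [mem_closedBall_zero_iff]
    refine ContinuousLinearMap.opNorm_le_bound _ zero_le_one fun x => ?_
    rw [one_mul]
    exact (Unitary.norm_map (⟨U, hU⟩ : OGroup d) x).le

/-- The image `U V` of a subspace `V` under an orthogonal map `U`. -/
def rotate {d r : ℕ} (U : OGroup d) (V : Gr d r) : Gr d r :=
  ⟨V.1.map (Unitary.linearIsometryEquiv U).toLinearEquiv.toLinearMap,
    (LinearEquiv.finrank_map_eq _ _).trans V.2⟩

theorem proj_rotate {d r : ℕ} (U : OGroup d) (V : Gr d r) :
    proj (rotate U V) = (U : Euc d →L[ℝ] Euc d) * proj V * star (U : Euc d →L[ℝ] Euc d) := by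
  ext1 x
  exact Submodule.starProjection_map_apply (Unitary.linearIsometryEquiv U) V.1 x

theorem measurable_rotate {d r : ℕ} (V : Gr d r) : Measurable fun U : OGroup d => rotate U V := by
  refine measurable_comap_iff.mpr ?_
  have h : (proj ∘ fun U : OGroup d => rotate U V) =
      fun U : OGroup d => (U : Euc d →L[ℝ] Euc d) * proj V * star (U : Euc d →L[ℝ] Euc d) := by
    funext U
    exact proj_rotate U V
  rw [h]
  exact Continuous.measurable (by fun_prop)

/-- The coordinate subspace spanned by the first `r` standard basis vectors. -/
def coordSubspace {d r : ℕ} (hr : r ≤ d) : Gr d r :=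
  ⟨Submodule.span ℝ (Set.range fun i : Fin r =>
      (EuclideanSpace.single (Fin.castLE hr i) (1 : ℝ) : Euc d)), by
    have h : LinearIndependent ℝ fun i : Fin r =>
        (EuclideanSpace.single (Fin.castLE hr i) (1 : ℝ) : Euc d) :=
      ((EuclideanSpace.orthonormal_single (𝕜 := ℝ) (ι := Fin d)).comp _
        (Fin.castLE_injective hr)).linearIndependent
    simpa using finrank_span_eq_card h⟩

/-- The Haar probability measure of the compact group `O(d)`. -/
def haarO (d : ℕ) : MeasureTheory.Measure (OGroup d) := MeasureTheory.Measure.haarMeasure ⊤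

/-- `Unif(Gr(d, r))`: the law of `U V₀` for a Haar distributed `U ∈ O(d)` and a fixed
`r`-dimensional subspace `V₀`. It is the rotation invariant probability measure on `Gr(d, r)`
(see `uniformGr_univ`, `uniformGr_map_rotate`), so it does not depend on the choice of `V₀`. -/
def uniformGr {d r : ℕ} (hr : r ≤ d) : MeasureTheory.Measure (Gr d r) :=
  (haarO d).map fun U => rotate U (coordSubspace hr)

theorem uniformGr_univ {d r : ℕ} (hr : r ≤ d) : uniformGr hr Set.univ = 1 := by
  rw [uniformGr, MeasureTheory.Measure.map_apply (measurable_rotate _) MeasurableSet.univ,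
    Set.preimage_univ]
  exact MeasureTheory.Measure.haarMeasure_self (K₀ := (⊤ : TopologicalSpace.PositiveCompacts (OGroup d)))

theorem rotate_mul {d r : ℕ} (U W : OGroup d) (V : Gr d r) :
    rotate (U * W) V = rotate U (rotate W V) := by
  apply Subtype.ext
  change V.1.map _ = (V.1.map _).map _
  rw [← Submodule.map_comp, map_mul]
  rfl

theorem measurable_rotate_left {d r : ℕ} (U : OGroup d) :
    Measurable fun V : Gr d r => rotate U V := by
  refine measurable_comap_iff.mpr ?_
  have h : (proj ∘ fun V : Gr d r => rotate U V) =
      (fun A : Euc d →L[ℝ] Euc d => (U : Euc d →L[ℝ] Euc d) * A *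
        star (U : Euc d →L[ℝ] Euc d)) ∘ proj := by
    funext V
    exact proj_rotate U V
  rw [h]
  exact (Continuous.measurable (by fun_prop)).comp (comap_measurable _)

theorem uniformGr_map_rotate {d r : ℕ} (hr : r ≤ d) (U : OGroup d) :
    (uniformGr hr).map (fun V => rotate U V) = uniformGr hr := by
  have h : (haarO d).map (fun W => U * W) = haarO d :=
    MeasureTheory.map_mul_left_eq_self (MeasureTheory.Measure.haarMeasure ⊤) U
  conv_rhs => rw [uniformGr, ← h]
  rw [uniformGr, MeasureTheory.Measure.map_map (measurable_rotate_left U) (measurable_rotate _),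
    MeasureTheory.Measure.map_map (measurable_rotate _) (measurable_const_mul U)]
  congr 1
  funext W
  exact (rotate_mul U W _).symm

/-- The ellipsoidal projection metric `‖S^{1/2} (P_V - P_W)‖_op`, where `S^{1/2}` is the positive
semidefinite square root of the positive semidefinite matrix `S`. -/
def ellDist {d r : ℕ} (S : Matrix (Fin d) (Fin d) ℝ) (V W : Gr d r) : ℝ :=
  ‖Matrix.toEuclideanCLM (n := Fin d) (𝕜 := ℝ) (CFC.sqrt S) ∘L (proj V - proj W)‖

/-- The closed ball of radius `ε` around `V` in the ellipsoidal projection metric. -/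
def ellBall {d r : ℕ} (S : Matrix (Fin d) (Fin d) ℝ) (V : Gr d r) (ε : ℝ) : Set (Gr d r) :=
  {W | ellDist S V W ≤ ε}

/-- The eigenvalues of a symmetric matrix, with multiplicity and in decreasing order
(so `eigval h 0` is the largest one). -/
def eigval {d : ℕ} {S : Matrix (Fin d) (Fin d) ℝ} (h : S.IsHermitian) (k : Fin d) : ℝ :=
  h.eigenvalues₀ (Fin.cast (Fintype.card_fin d).symm k)

end GrassmannCover

end

noncomputable section

open scoped MatrixOrder

namespace GrassmannCover

open MeasureTheory Module

/-! The ball contains an explicit family of graphs over `V`, and its volume can be bounded below.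
Put m = d - r and choose orthonormal frames of `V` and `Vᗮ` that diagonalise the compressions of
`S`, with decreasing entries a and b. For ‖Y‖ ≤ 1 let X = diag(β) Y diag(α), where α_j = ε /
√(max(a_j, ε²)) and β_i is half the same expression in b_i. Then S^{1/2} X and S^{1/2} X* both have
norm at most ε/2, so the graph of X lies in the ball (`norm_comp_starProjection_sub_graph_le`). The
map Y ↦ X has determinant ∏ β_i α_j (`det_sandwich`), and interlacing lets the eigenvalues λ replace
a and b.

To pass from volume to Haar measure, note that Lebesgue measure on Hom(ℝ^r, ℝ^d) and the
operator-norm unit ball are O(d)-invariant. Hence the uniform measure of a set of subspaces is at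
least the proportion of maps in the unit ball whose range lies in it (`addHaar_le_haarO_mul`).
Fubini bounds that proportion for the graphs above (`le_prod_graphPairs`). The loss 8^(-r²) is
absorbed when r ≤ m; otherwise one passes to orthogonal complements (`rotate_compl_mem_ellBall`). -/

/-! ### Distance from a subspace to a graph over it -/

/-- If `W` is the graph of `X` over `V = range J₁`, with values in `Vᗮ = range J₂`, then the
ellipsoidal distance of `V` and `W` is controlled by `X` and its adjoint. -/
theorem norm_comp_starProjection_sub_graph_le {r m d : ℕ} (J₁ : Euc r →ₗᵢ[ℝ] Euc d)
    (J₂ : Euc m →ₗᵢ[ℝ] Euc d) {V W : Submodule ℝ (Euc d)}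
    (hV : LinearMap.range J₁.toLinearMap = V) (hV' : LinearMap.range J₂.toLinearMap = Vᗮ)
    (X : Euc r →L[ℝ] Euc m) (hW : ∀ x, x ∈ W ↔ ∃ v, J₁ v + J₂ (X v) = x)
    (A : Euc d →L[ℝ] Euc d) {δ : ℝ} (hδ : 0 ≤ δ)
    (h₁ : ∀ v, ‖A (J₂ (X v))‖ ≤ δ * ‖v‖)
    (h₂ : ∀ w, ‖A (J₁ (ContinuousLinearMap.adjoint X w))‖ ≤ δ * ‖w‖) :
    ‖A ∘L (V.starProjection - W.starProjection)‖ ≤ 2 * δ := by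
  have hJ₁ : ∀ v, J₁ v ∈ V := fun v => hV ▸ LinearMap.mem_range_self J₁.toLinearMap v
  have hJ₂ : ∀ w, J₂ w ∈ Vᗮ := fun w => hV' ▸ LinearMap.mem_range_self J₂.toLinearMap w
  have horth : ∀ v w, inner ℝ (J₁ v) (J₂ w) = 0 := fun v w =>
    (Submodule.mem_orthogonal V _).1 (hJ₂ w) _ (hJ₁ v)
  have hPV : ∀ v w, V.starProjection (J₁ v + J₂ w) = J₁ v := fun v w =>
    Submodule.eq_starProjection_of_mem_orthogonal' (hJ₁ v) (hJ₂ w) rfl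
  have hnorm : ∀ v w, ‖J₁ v + J₂ w‖ ^ 2 = ‖v‖ ^ 2 + ‖w‖ ^ 2 := fun v w => by
    rw [norm_add_sq_real, horth]; simp
  have hdecomp : ∀ x, ∃ v w, J₁ v + J₂ w = x := fun x => by
    have hx : V.starProjection x ∈ LinearMap.range J₁.toLinearMap :=
      hV ▸ Submodule.starProjection_apply_mem V x
    have hx' : x - V.starProjection x ∈ LinearMap.range J₂.toLinearMap :=
      hV' ▸ Submodule.sub_starProjection_mem_orthogonal x
    obtain ⟨v, hv⟩ := hx
    obtain ⟨w, hw⟩ := hx'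
    refine ⟨v, w, ?_⟩
    change J₁ v = _ at hv
    change J₂ w = _ at hw
    rw [hv, hw]; abel
  refine ContinuousLinearMap.opNorm_le_bound _ (by positivity) fun x => ?_
  obtain ⟨v, hv⟩ := (hW _).1 (Submodule.starProjection_apply_mem W x)
  obtain ⟨a, b, hab⟩ := hdecomp (x - W.starProjection x)
  have hperp : x - W.starProjection x ∈ Wᗮ := Submodule.sub_starProjection_mem_orthogonal x
  -- The complement of the graph of X is the graph of -X* over `Vᗮ`: pairing with the graph point
  -- over u = a + X*b gives ‖u‖² = 0.
  have ha : a = - ContinuousLinearMap.adjoint X b := by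
    rw [eq_neg_iff_add_eq_zero, ← inner_self_eq_zero (𝕜 := ℝ)]
    set u := a + ContinuousLinearMap.adjoint X b with hu
    have h := (Submodule.mem_orthogonal W _).1 hperp _ ((hW _).2 ⟨u, rfl⟩)
    rw [← hab, inner_add_left, inner_add_right, inner_add_right, horth,
      real_inner_comm (J₁ a) (J₂ (X u)), horth, J₁.inner_map_map, J₂.inner_map_map,
      ← ContinuousLinearMap.adjoint_inner_right] at h
    calc inner ℝ u u = inner ℝ u a + inner ℝ u (ContinuousLinearMap.adjoint X b) := by
          conv_lhs => rw [hu]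
          rw [← inner_add_right]
      _ = 0 := by linarith
  have hx : x = (J₁ v + J₂ (X v)) + (J₁ a + J₂ b) := by rw [hv, hab]; abel
  have hxn : ‖x‖ ^ 2 = (‖v‖ ^ 2 + ‖X v‖ ^ 2) + (‖a‖ ^ 2 + ‖b‖ ^ 2) := by
    have h0 : inner ℝ (J₁ v + J₂ (X v)) (J₁ a + J₂ b) = 0 := by
      rw [hab]
      exact (Submodule.mem_orthogonal W _).1 hperp _ ((hW _).2 ⟨v, rfl⟩)
    rw [hx, norm_add_sq_real, h0, hnorm, hnorm]; ring
  have hvx : ‖v‖ ≤ ‖x‖ := by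
    apply le_of_sq_le_sq _ (norm_nonneg _)
    nlinarith [sq_nonneg ‖X v‖, sq_nonneg ‖a‖, sq_nonneg ‖b‖]
  have hbx : ‖b‖ ≤ ‖x‖ := by
    apply le_of_sq_le_sq _ (norm_nonneg _)
    nlinarith [sq_nonneg ‖X v‖, sq_nonneg ‖a‖, sq_nonneg ‖v‖]
  have hdiff : (V.starProjection - W.starProjection) x = J₁ a - J₂ (X v) := by
    have hVx : V.starProjection x = J₁ v + J₁ a := by
      conv_lhs => rw [hx]
      rw [map_add, hPV, hPV]
    rw [sub_apply, hVx, ← hv]; abel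
  rw [ContinuousLinearMap.comp_apply, hdiff, map_sub]
  calc ‖A (J₁ a) - A (J₂ (X v))‖ ≤ ‖A (J₁ a)‖ + ‖A (J₂ (X v))‖ := norm_sub_le _ _
    _ ≤ δ * ‖b‖ + δ * ‖v‖ := by
        gcongr
        · rw [ha, map_neg, map_neg, norm_neg]; exact h₂ b
        · exact h₁ v
    _ ≤ δ * ‖x‖ + δ * ‖x‖ := by gcongr
    _ = 2 * δ * ‖x‖ := by ring

/-! ### Interlacing and diagonalising frames -/

/-- Cauchy interlacing, upper half: if a symmetric operator is diagonal on an orthonormal family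
with decreasing entries `a`, then `a k` is at most its `k`-th largest eigenvalue. -/
theorem diagonal_entry_le_eigenvalue {E : Type*} [NormedAddCommGroup E] [InnerProductSpace ℝ E]
    [FiniteDimensional ℝ E] {n r : ℕ} (hn : finrank ℝ E = n) {T : E →ₗ[ℝ] E}
    (hT : T.IsSymmetric) (J : Euc r →ₗᵢ[ℝ] E) {a : Fin r → ℝ} (ha : Antitone a)
    (hJ : ∀ u, inner ℝ (J u) (T (J u)) = ∑ j, a j * u j ^ 2) (hr : r ≤ n) (k : Fin r) :
    a k ≤ hT.eigenvalues hn (Fin.castLE hr k) := by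
  let b := hT.eigenvectorBasis hn
  -- Only r - 1 conditions: they kill the coordinates of u beyond k and the components of J u along
  -- the first k eigenvectors. A nonzero u survives, and its Rayleigh quotient lies between the two
  -- quantities.
  let L : Euc r →ₗ[ℝ] ({j : Fin r // j ≠ k} → ℝ) := LinearMap.pi fun j =>
    if k < j.1 then (EuclideanSpace.proj j.1 : Euc r →L[ℝ] ℝ).toLinearMap
    else (innerSL ℝ (b (Fin.castLE hr j.1))).toLinearMap ∘ₗ J.toLinearMap
  have hker : LinearMap.ker L ≠ ⊥ := by
    apply LinearMap.ker_ne_bot_of_finrank_lt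
    have := k.pos
    simp [Fintype.card_subtype_compl]
    omega
  obtain ⟨u, hu, hu0⟩ := (Submodule.ne_bot_iff _).1 hker
  have hLu : ∀ j : {j : Fin r // j ≠ k}, L u j = 0 := fun j => congrFun hu j
  have hup : ∀ j, k < j → u j = 0 := fun j hj => by
    have h := hLu ⟨j, hj.ne'⟩
    simpa [L, hj] using h
  have hdown : ∀ i : Fin n, (i : ℕ) < k → b.repr (J u) i = 0 := fun i hi => by
    have hik : (⟨i, hi.trans k.2⟩ : Fin r) < k := hi
    have h := hLu ⟨⟨i, hi.trans k.2⟩, hik.ne⟩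
    rw [b.repr_apply_apply]
    simpa [L, hik.not_gt] using h
  have hlow : a k * ‖u‖ ^ 2 ≤ inner ℝ (J u) (T (J u)) := by
    rw [hJ, EuclideanSpace.real_norm_sq_eq, Finset.mul_sum]
    refine Finset.sum_le_sum fun j _ => ?_
    rcases le_or_gt j k with h | h
    · exact mul_le_mul_of_nonneg_right (ha h) (sq_nonneg _)
    · simp [hup j h]
  have hhigh : inner ℝ (J u) (T (J u)) ≤ hT.eigenvalues hn (Fin.castLE hr k) * ‖u‖ ^ 2 := by
    rw [← J.norm_map u, ← b.repr.norm_map, ← b.repr.inner_map_map, PiLp.inner_apply,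
      EuclideanSpace.real_norm_sq_eq, Finset.mul_sum]
    refine Finset.sum_le_sum fun i _ => ?_
    rw [hT.eigenvectorBasis_apply_self_apply hn]
    rcases le_or_gt (k : ℕ) i with h | h
    · have h' : hT.eigenvalues hn i ≤ hT.eigenvalues hn (Fin.castLE hr k) :=
        hT.eigenvalues_antitone hn h
      have h2 := mul_le_mul_of_nonneg_right h' (sq_nonneg (b.repr (J u) i))
      calc _ = hT.eigenvalues hn i * b.repr (J u) i ^ 2 := by
            simp [b]
            ring
        _ ≤ _ := h2
    · have h0 := hdown i h
      simp only [b] at h0 ⊢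
      simp [h0]
  have hpos : 0 < ‖u‖ ^ 2 := by positivity
  exact le_of_mul_le_mul_right (hlow.trans hhigh) hpos

/-- Every subspace is the range of an isometry that diagonalises a given symmetric operator. -/
theorem exists_isometry_diagonalising {E : Type*} [NormedAddCommGroup E] [InnerProductSpace ℝ E]
    [FiniteDimensional ℝ E] {T : E →ₗ[ℝ] E} (hT : T.IsSymmetric) (V : Submodule ℝ E) {r : ℕ}
    (hV : finrank ℝ V = r) :
    ∃ (J : Euc r →ₗᵢ[ℝ] E) (a : Fin r → ℝ), LinearMap.range J.toLinearMap = V ∧ Antitone a ∧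
      ∀ u, inner ℝ (J u) (T (J u)) = ∑ j, a j * u j ^ 2 := by
  let T' : V →ₗ[ℝ] V := V.orthogonalProjectionOnto.toLinearMap ∘ₗ T ∘ₗ V.subtype
  have hin : ∀ x y : V, inner ℝ x (T' y) = inner ℝ (x : E) (T y) := fun x y => by
    simp [T']
  have hT' : T'.IsSymmetric := fun x y => by
    rw [hin, real_inner_comm, hin, real_inner_comm]
    exact hT _ _
  let b := hT'.eigenvectorBasis hV
  refine ⟨V.subtypeₗᵢ.comp b.repr.symm.toLinearIsometry, hT'.eigenvalues hV, ?_,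
    hT'.eigenvalues_antitone hV, fun u => ?_⟩
  · ext x
    constructor
    · rintro ⟨u, rfl⟩
      exact (b.repr.symm u).2
    · intro hx
      exact ⟨b.repr ⟨x, hx⟩, by simp⟩
  · change inner ℝ ((b.repr.symm u : V) : E) (T (b.repr.symm u : V)) = _
    rw [← hin, ← b.repr.inner_map_map, PiLp.inner_apply]
    refine Finset.sum_congr rfl fun j _ => ?_
    rw [hT'.eigenvectorBasis_apply_self_apply hV]
    simp [b]
    ring

/-! ### Haar measure on O(d) against Lebesgue measure on linear maps -/

/-- A right translate is again a left Haar probability measure, so uniqueness applies. -/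
instance isMulRightInvariant_haarO (d : ℕ) : (haarO d).IsMulRightInvariant := by
  have : IsProbabilityMeasure (haarO d) := ⟨Measure.haarMeasure_self⟩
  have : (haarO d).IsHaarMeasure := inferInstanceAs (Measure.haarMeasure ⊤).IsHaarMeasure
  refine ⟨fun R => ?_⟩
  have : IsProbabilityMeasure ((haarO d).map (· * R)) :=
    Measure.isProbabilityMeasure_map (measurable_mul_const R).aemeasurable
  exact Measure.isHaarMeasure_eq_of_isProbabilityMeasure _ _

instance isProbabilityMeasure_haarO (d : ℕ) : IsProbabilityMeasure (haarO d) :=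
  ⟨Measure.haarMeasure_self⟩

/-- An isometry between the two subspaces extends to the whole space. -/
theorem exists_rotate_eq {d r : ℕ} (V W : Gr d r) : ∃ R : OGroup d, rotate R V = W := by
  let e : V.1 ≃ₗᵢ[ℝ] W.1 := (stdOrthonormalBasis ℝ V.1).equiv (stdOrthonormalBasis ℝ W.1)
    (finCongr (V.2.trans W.2.symm))
  let f : V.1 →ₗᵢ[ℝ] Euc d := W.1.subtypeₗᵢ.comp e.toLinearIsometry
  let g : Euc d ≃ₗᵢ[ℝ] Euc d := f.extend.toLinearIsometryEquiv rfl
  refine ⟨Unitary.linearIsometryEquiv.symm g, Subtype.ext ?_⟩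
  change V.1.map (Unitary.linearIsometryEquiv _).toLinearEquiv.toLinearMap = W.1
  rw [MulEquiv.apply_symm_apply]
  have hg : ∀ x : V.1, g x = e x := fun x => LinearIsometry.extend_apply f x
  ext y
  constructor
  · rintro ⟨x, hx, rfl⟩
    have := hg ⟨x, hx⟩
    change g x ∈ W.1
    rw [this]
    exact (e _).2
  · intro hy
    refine ⟨e.symm ⟨y, hy⟩, (e.symm ⟨y, hy⟩).2, ?_⟩
    change g _ = y
    rw [hg]
    simp

/-- Left multiplication by an orthogonal map preserves the volume of sets of linear maps. -/
theorem addHaar_preimage_unitary_comp {d r : ℕ} (ν : Measure (Euc r →L[ℝ] Euc d))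
    [ν.IsAddHaarMeasure] (U : OGroup d) (s : Set (Euc r →L[ℝ] Euc d)) :
    ν {M | (U : Euc d →L[ℝ] Euc d) ∘L M ∈ s} = ν s := by
  let L : (Euc r →L[ℝ] Euc d) →ₗ[ℝ] (Euc r →L[ℝ] Euc d) :=
    (ContinuousLinearMap.compL ℝ (Euc r) (Euc d) (Euc d) (U : Euc d →L[ℝ] Euc d)).toLinearMap
  have hL : ∀ M, ‖L M‖ = ‖M‖ := fun M => by
    refine le_antisymm (ContinuousLinearMap.opNorm_le_bound _ (norm_nonneg _) fun x => ?_)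
      (ContinuousLinearMap.opNorm_le_bound _ (norm_nonneg _) fun x => ?_)
    · exact (Unitary.norm_map U (M x)).le.trans (M.le_opNorm x)
    · exact (Unitary.norm_map U (M x)).ge.trans ((L M).le_opNorm x)
  have hinj : Function.Injective L := (injective_iff_map_eq_zero L).2 fun M hM => by
    rw [← norm_eq_zero, ← hL, hM, norm_zero]
  have hdet : LinearMap.det L ≠ 0 := by
    have := (LinearEquiv.ofInjectiveEndo L hinj).isUnit_det'
    exact this.ne_zero
  -- The preserved ball has finite positive volume, which forces |det L| = 1.
  have hball : L ⁻¹' Metric.closedBall 0 1 = Metric.closedBall 0 1 := by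
    ext M; simp [hL]
  have h1 := Measure.addHaar_preimage_linearMap ν hdet (Metric.closedBall 0 1)
  rw [hball] at h1
  have hfin : ν (Metric.closedBall 0 1) ≠ ⊤ := measure_closedBall_lt_top.ne
  have hpos : ν (Metric.closedBall 0 1) ≠ 0 :=
    (Metric.measure_closedBall_pos ν _ one_pos).ne'
  have h2 : ENNReal.ofReal |(LinearMap.det L)⁻¹| = 1 := by
    have := (ENNReal.mul_left_inj hpos hfin (a := 1) (b := ENNReal.ofReal |(LinearMap.det L)⁻¹|)).1
      (by rwa [one_mul])
    exact this.symm
  have h3 := Measure.addHaar_preimage_linearMap ν hdet s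
  rw [h2, one_mul] at h3
  exact h3

/-- The uniform measure of a set of subspaces is at least the proportion of linear maps in the
unit ball whose range lies in this set. -/
theorem addHaar_le_haarO_mul {d r : ℕ} (ν : Measure (Euc r →L[ℝ] Euc d))
    [ν.IsAddHaarMeasure] (V : Gr d r) (B : Set (Gr d r)) {s : Set (Euc r →L[ℝ] Euc d)}
    (hs : MeasurableSet s) (hs1 : s ⊆ Metric.closedBall 0 1)
    (hB : ∀ M ∈ s, ∃ W ∈ B, W.1 = LinearMap.range M.toLinearMap) :
    ν s ≤ haarO d {U | rotate U V ∈ B} * ν (Metric.closedBall 0 1) := by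
  -- Double counting: sections at fixed U all have volume `ν s`, while sections at fixed M are
  -- bounded in `key`.
  let t : Set (OGroup d × (Euc r →L[ℝ] Euc d)) := {p | (p.1 : Euc d →L[ℝ] Euc d) ∘L p.2 ∈ s}
  have ht : MeasurableSet t := by
    have hc : Continuous fun p : OGroup d × (Euc r →L[ℝ] Euc d) =>
        (p.1 : Euc d →L[ℝ] Euc d) ∘L p.2 := by fun_prop
    exact hc.measurable hs
  have e1 : ((haarO d).prod ν) t = ν s := by
    rw [Measure.prod_apply ht]
    have : ∀ U : OGroup d, ν (Prod.mk U ⁻¹' t) = ν s := fun U =>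
      addHaar_preimage_unitary_comp ν U s
    simp [this]
  have key : ∀ M, haarO d ((fun U => (U, M)) ⁻¹' t) ≤ (Metric.closedBall 0 1).indicator
      (fun _ => haarO d {U | rotate U V ∈ B}) M := fun M => by
    rcases Set.eq_empty_or_nonempty ((fun U => (U, M)) ⁻¹' t) with h | ⟨U₀, hU₀⟩
    · rw [h, measure_empty]; exact zero_le
    have hmem : ∀ U : OGroup d, (U : Euc d →L[ℝ] Euc d) ∘L M ∈ s → ∃ W ∈ B,
        W.1 = (LinearMap.range M.toLinearMap).map
          (Unitary.linearIsometryEquiv U).toLinearEquiv.toLinearMap := fun U hU => by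
      obtain ⟨W, hW, hWe⟩ := hB _ hU
      refine ⟨W, hW, hWe.trans ?_⟩
      rw [← LinearMap.range_comp]
      rfl
    have hball : M ∈ Metric.closedBall (0 : Euc r →L[ℝ] Euc d) 1 := by
      have h := hs1 hU₀
      rw [mem_closedBall_zero_iff] at h ⊢
      refine le_trans (ContinuousLinearMap.opNorm_le_bound _ (norm_nonneg _) fun x => ?_) h
      exact (Unitary.norm_map U₀ (M x)).ge.trans
        (ContinuousLinearMap.le_opNorm ((U₀ : Euc d →L[ℝ] Euc d) ∘L M) x)
    rw [Set.indicator_of_mem hball]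
    obtain ⟨W₀, -, hW₀⟩ := hmem U₀ hU₀
    let W : Gr d r := ⟨LinearMap.range M.toLinearMap, by
      have h := W₀.2
      rwa [hW₀, LinearEquiv.finrank_map_eq] at h⟩
    -- With range M = R V, the section at M lies in a right translate of the target event, hence
    -- right invariance is what is needed.
    obtain ⟨R, hR⟩ := exists_rotate_eq V W
    calc haarO d ((fun U => (U, M)) ⁻¹' t)
        ≤ haarO d ((fun U => U * R) ⁻¹' {U | rotate U V ∈ B}) := by
          refine measure_mono fun U hU => ?_
          obtain ⟨W', hW'B, hW'⟩ := hmem U hU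
          change rotate (U * R) V ∈ B
          rw [rotate_mul, hR]
          have : rotate U W = W' := Subtype.ext hW'.symm
          rwa [this]
      _ = _ := measure_preimage_mul_right _ _ _
  calc ν s = ∫⁻ M, haarO d ((fun U => (U, M)) ⁻¹' t) ∂ν := by
        rw [← e1, Measure.prod_apply_symm ht]
    _ ≤ ∫⁻ M, (Metric.closedBall 0 1).indicator
          (fun _ => haarO d {U | rotate U V ∈ B}) M ∂ν := lintegral_mono key
    _ = _ := by
        rw [lintegral_indicator Metric.isClosed_closedBall.measurableSet, lintegral_const]
        simp

/-! ### Diagonal operators and determinants -/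

/-- The operator with diagonal matrix `α` in the standard basis. -/
def diagOp {n : ℕ} (α : Fin n → ℝ) : Euc n →L[ℝ] Euc n :=
  Matrix.toEuclideanCLM (n := Fin n) (𝕜 := ℝ) (Matrix.diagonal α)

@[simp]
theorem diagOp_apply {n : ℕ} (α : Fin n → ℝ) (x : Euc n) (i : Fin n) :
    diagOp α x i = α i * x i := by
  simp [diagOp, Matrix.mulVec_diagonal]

theorem adjoint_diagOp {n : ℕ} (α : Fin n → ℝ) :
    ContinuousLinearMap.adjoint (diagOp α) = diagOp α := by
  symm
  rw [ContinuousLinearMap.eq_adjoint_iff]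
  intro x y
  simp only [PiLp.inner_apply, diagOp_apply]
  refine Finset.sum_congr rfl fun i _ => ?_
  simp
  ring

theorem norm_diagOp_le {n : ℕ} {α : Fin n → ℝ} {c : ℝ} (hc : 0 ≤ c) (hα : ∀ i, |α i| ≤ c) :
    ‖diagOp α‖ ≤ c := by
  refine ContinuousLinearMap.opNorm_le_bound _ hc fun x => ?_
  apply le_of_sq_le_sq _ (by positivity)
  rw [mul_pow, EuclideanSpace.real_norm_sq_eq, EuclideanSpace.real_norm_sq_eq, Finset.mul_sum]
  refine Finset.sum_le_sum fun i _ => ?_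
  rw [diagOp_apply, mul_pow]
  exact mul_le_mul_of_nonneg_right (sq_le_sq.2 ((hα i).trans (le_abs_self c))) (sq_nonneg _)

/-- The map `Y ↦ diag(β) Y diag(α)`. -/
def sandwich {r m : ℕ} (α : Fin r → ℝ) (β : Fin m → ℝ) :
    (Euc r →L[ℝ] Euc m) →ₗ[ℝ] (Euc r →L[ℝ] Euc m) where
  toFun Y := diagOp β ∘L Y ∘L diagOp α
  map_add' Y Z := by ext; simp
  map_smul' c Y := by ext; simp

theorem sandwich_apply {r m : ℕ} (α : Fin r → ℝ) (β : Fin m → ℝ) (Y : Euc r →L[ℝ] Euc m) :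
    sandwich α β Y = diagOp β ∘L Y ∘L diagOp α := rfl

/-- In matrix coordinates the map is diagonal: entry (i, j) is multiplied by β_i α_j. -/
theorem det_sandwich {r m : ℕ} (α : Fin r → ℝ) (β : Fin m → ℝ) :
    LinearMap.det (sandwich α β) = ∏ i, ∏ j, β i * α j := by
  let e : (Euc r →L[ℝ] Euc m) ≃ₗ[ℝ] (Fin m → Fin r → ℝ) :=
    LinearMap.toContinuousLinearMap.symm ≪≫ₗ
      (LinearMap.toMatrix (EuclideanSpace.basisFun (Fin r) ℝ).toBasis
        (EuclideanSpace.basisFun (Fin m) ℝ).toBasis)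
  have he : ∀ Y i j, e Y i j = Y (EuclideanSpace.single j 1) i := fun Y i j => by
    change LinearMap.toMatrix _ _ _ i j = _
    simp [LinearMap.toMatrix_apply]
  have hd : ∀ j, diagOp α (EuclideanSpace.single j 1) = α j • EuclideanSpace.single j (1 : ℝ) := by
    intro j
    ext i
    rw [diagOp_apply]
    by_cases h : i = j
    · subst h; simp
    · simp [h]
  have hconj : e.toLinearMap ∘ₗ sandwich α β ∘ₗ e.symm.toLinearMap =
      LinearMap.pi fun i => (LinearMap.pi fun j =>
        ((β i * α j) • (LinearMap.id : ℝ →ₗ[ℝ] ℝ)) ∘ₗ LinearMap.proj j) ∘ₗ LinearMap.proj i := by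
    refine LinearMap.ext fun Z => ?_
    obtain ⟨Y, rfl⟩ := e.surjective Z
    funext i j
    simp [he, sandwich_apply, hd]
    ring
  rw [← LinearMap.det_conj (sandwich α β) e, hconj, LinearMap.det_pi]
  simp [LinearMap.det_pi]

/-- The image of the unit ball contains the ball of radius c; compare volumes. -/
theorem pow_finrank_le_abs_det {F : Type*} [NormedAddCommGroup F] [NormedSpace ℝ F]
    [FiniteDimensional ℝ F] (f : F →ₗ[ℝ] F) {c : ℝ} (hc : 0 < c)
    (hf : ∀ x, c * ‖x‖ ≤ ‖f x‖) : c ^ finrank ℝ F ≤ |LinearMap.det f| := by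
  borelize F
  let μ : Measure F := Measure.addHaar
  have hinj : Function.Injective f := (injective_iff_map_eq_zero f).2 fun x hx => by
    have h := hf x
    rw [hx, norm_zero] at h
    exact norm_le_zero_iff.1 (nonpos_of_mul_nonpos_right h hc)
  have hsub : Metric.closedBall 0 c ⊆ f '' Metric.closedBall 0 1 := fun y hy => by
    obtain ⟨x, rfl⟩ := LinearMap.injective_iff_surjective.1 hinj y
    refine ⟨x, ?_, rfl⟩
    rw [mem_closedBall_zero_iff] at hy ⊢
    exact le_of_mul_le_mul_left (by linarith [hf x]) hc
  have h := measure_mono (μ := μ) hsub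
  rw [Measure.addHaar_image_linearMap, Measure.addHaar_closedBall' μ _ hc.le] at h
  have h' := (ENNReal.mul_le_mul_iff_left
    (Metric.measure_closedBall_pos μ (0 : F) one_pos).ne' measure_closedBall_lt_top.ne).1 h
  exact (ENNReal.ofReal_le_ofReal_iff (abs_nonneg _)).1 h'

theorem finrank_euc_clm (r m : ℕ) : finrank ℝ (Euc r →L[ℝ] Euc m) = r * m := by
  rw [← (LinearMap.toContinuousLinearMap (𝕜 := ℝ) (E := Euc r) (F' := Euc m)).finrank_eq,
    finrank_linearMap]
  simp

/-! ### Volume of the maps whose range is an admissible graph -/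

/-- Pairs `(M, T(Y) M)` with `M` close to `1 / 4` and `Y` in the unit ball. -/
def graphPairs {r m : ℕ} (T : (Euc r →L[ℝ] Euc m) →ₗ[ℝ] (Euc r →L[ℝ] Euc m)) :
    Set ((Euc r →L[ℝ] Euc r) × (Euc r →L[ℝ] Euc m)) :=
  (fun p : (Euc r →L[ℝ] Euc r) × (Euc r →L[ℝ] Euc m) => (p.1, T p.2 ∘L p.1)) ''
    (Metric.closedBall ((1 / 4 : ℝ) • ContinuousLinearMap.id ℝ (Euc r)) (1 / 8) ×ˢ
      Metric.closedBall 0 1)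

theorem isCompact_graphPairs {r m : ℕ}
    (T : (Euc r →L[ℝ] Euc m) →ₗ[ℝ] (Euc r →L[ℝ] Euc m)) : IsCompact (graphPairs T) := by
  refine ((isCompact_closedBall _ _).prod (isCompact_closedBall _ _)).image ?_
  have hT : Continuous T := T.continuous_of_finiteDimensional
  fun_prop

/-- The lower bound makes M invertible; the factor 1/2 leaves room for M and T(Y) M to be glued
inside the unit ball. -/
theorem norm_le_of_mem_closedBall {r : ℕ} {M : Euc r →L[ℝ] Euc r}
    (hM : M ∈ Metric.closedBall ((1 / 4 : ℝ) • ContinuousLinearMap.id ℝ (Euc r)) (1 / 8))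
    (x : Euc r) : 1 / 8 * ‖x‖ ≤ ‖M x‖ ∧ ‖M x‖ ≤ 1 / 2 * ‖x‖ := by
  rw [mem_closedBall_iff_norm] at hM
  have h := (M - (1 / 4 : ℝ) • ContinuousLinearMap.id ℝ (Euc r)).le_of_opNorm_le hM x
  have h2 : ‖(1 / 4 : ℝ) • x‖ = 1 / 4 * ‖x‖ := by rw [norm_smul]; norm_num
  have h3 : (M - (1 / 4 : ℝ) • ContinuousLinearMap.id ℝ (Euc r)) x = M x - (1 / 4 : ℝ) • x := by
    simp
  rw [h3] at h
  have h4 := norm_sub_norm_le (M x) ((1 / 4 : ℝ) • x)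
  have h5 := norm_sub_norm_le ((1 / 4 : ℝ) • x) (M x)
  rw [norm_sub_rev] at h5
  rw [h2] at h4 h5
  have := norm_nonneg x
  constructor <;> linarith

/-- Fubini over M: the ball of radius 1/8 contributes 8^(-r²). Each section contains the image of
the unit ball under Y ↦ T(Y) M, where composing with M costs at most 8^(-rm). -/
theorem le_prod_graphPairs {r m : ℕ} (μ₁ : Measure (Euc r →L[ℝ] Euc r)) [μ₁.IsAddHaarMeasure]
    (μ₂ : Measure (Euc r →L[ℝ] Euc m)) [μ₂.IsAddHaarMeasure]
    (T : (Euc r →L[ℝ] Euc m) →ₗ[ℝ] (Euc r →L[ℝ] Euc m)) :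
    ENNReal.ofReal ((1 / 8) ^ (r * r) * ((1 / 8) ^ (r * m) * |LinearMap.det T|)) *
      (μ₁ (Metric.closedBall 0 1) * μ₂ (Metric.closedBall 0 1)) ≤ (μ₁.prod μ₂) (graphPairs T) := by
  set D := Metric.closedBall ((1 / 4 : ℝ) • ContinuousLinearMap.id ℝ (Euc r)) (1 / 8) with hD
  rw [Measure.prod_apply (isCompact_graphPairs T).measurableSet]
  have hsec : ∀ M ∈ D, ENNReal.ofReal ((1 / 8) ^ (r * m) * |LinearMap.det T|) *
      μ₂ (Metric.closedBall 0 1) ≤ μ₂ (Prod.mk M ⁻¹' graphPairs T) := fun M hM => by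
    let R : (Euc r →L[ℝ] Euc m) →ₗ[ℝ] (Euc r →L[ℝ] Euc m) :=
      ((ContinuousLinearMap.compL ℝ (Euc r) (Euc r) (Euc m)).flip M).toLinearMap
    have hR : ∀ Y, R Y = Y ∘L M := fun Y => rfl
    have hMinj : Function.Injective M := (injective_iff_map_eq_zero M).2 fun x hx => by
      have h := (norm_le_of_mem_closedBall hM x).1
      rw [hx, norm_zero] at h
      exact norm_le_zero_iff.1 (by linarith)
    have hdet : (1 / 8) ^ (r * m) ≤ |LinearMap.det R| := by
      rw [← finrank_euc_clm r m]
      refine pow_finrank_le_abs_det R (by norm_num) fun Y => ?_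
      have h : ‖Y‖ ≤ 8 * ‖R Y‖ := by
        refine ContinuousLinearMap.opNorm_le_bound _ (by positivity) fun y => ?_
        obtain ⟨x, rfl⟩ := LinearMap.injective_iff_surjective (f := M.toLinearMap).1 hMinj y
        have h1 := (R Y).le_opNorm x
        have h2 := (norm_le_of_mem_closedBall hM x).1
        calc ‖Y (M x)‖ ≤ ‖R Y‖ * ‖x‖ := h1
          _ ≤ ‖R Y‖ * (8 * ‖M x‖) := by gcongr; linarith
          _ = 8 * ‖R Y‖ * ‖M x‖ := by ring
      linarith
    have hsub : (R ∘ₗ T) '' Metric.closedBall 0 1 ⊆ Prod.mk M ⁻¹' graphPairs T := by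
      rintro _ ⟨Y, hY, rfl⟩
      exact ⟨(M, Y), ⟨hM, hY⟩, rfl⟩
    refine le_trans ?_ (measure_mono hsub)
    rw [Measure.addHaar_image_linearMap, LinearMap.det_comp, abs_mul]
    gcongr
  have hvol : μ₁ D = ENNReal.ofReal ((1 / 8) ^ (r * r)) * μ₁ (Metric.closedBall 0 1) := by
    rw [hD, Measure.addHaar_closedBall' μ₁ _ (by norm_num), finrank_euc_clm]
  calc _ = ∫⁻ _ in D, ENNReal.ofReal ((1 / 8) ^ (r * m) * |LinearMap.det T|) *
      μ₂ (Metric.closedBall 0 1) ∂μ₁ := by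
        rw [setLIntegral_const, hvol, ENNReal.ofReal_mul (by positivity)]
        ring
    _ ≤ ∫⁻ M in D, μ₂ (Prod.mk M ⁻¹' graphPairs T) ∂μ₁ :=
        setLIntegral_mono' Metric.isClosed_closedBall.measurableSet hsec
    _ ≤ _ := setLIntegral_le_lintegral _ _

/-- `Hom(ℝ^r, ℝ^d)` splits along an orthogonal decomposition of `ℝ^d`. -/
def glue {r m d : ℕ} (hd : r + m = d) (J₁ : Euc r →ₗᵢ[ℝ] Euc d) (J₂ : Euc m →ₗᵢ[ℝ] Euc d)
    (horth : ∀ v w, inner ℝ (J₁ v) (J₂ w) = 0) :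
    ((Euc r →L[ℝ] Euc r) × (Euc r →L[ℝ] Euc m)) ≃L[ℝ] (Euc r →L[ℝ] Euc d) :=
  (LinearEquiv.ofInjectiveOfFinrankEq
    ((ContinuousLinearMap.compL ℝ (Euc r) (Euc r) (Euc d)
        J₁.toContinuousLinearMap).toLinearMap.coprod
      (ContinuousLinearMap.compL ℝ (Euc r) (Euc m) (Euc d) J₂.toContinuousLinearMap).toLinearMap)
    (by
      refine (injective_iff_map_eq_zero _).2 fun p hp => ?_
      have h : ∀ x, p.1 x = 0 ∧ p.2 x = 0 := fun x => by
        have hx : J₁ (p.1 x) + J₂ (p.2 x) = 0 := congrArg (fun M => M x) hp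
        have hn : ‖J₁ (p.1 x) + J₂ (p.2 x)‖ ^ 2 = ‖p.1 x‖ ^ 2 + ‖p.2 x‖ ^ 2 := by
          rw [norm_add_sq_real, horth]; simp
        rw [hx, norm_zero] at hn
        constructor <;> rw [← norm_eq_zero] <;>
          nlinarith [norm_nonneg (p.1 x), norm_nonneg (p.2 x)]
      exact Prod.ext (ContinuousLinearMap.ext fun x => (h x).1)
        (ContinuousLinearMap.ext fun x => (h x).2))
    (by rw [finrank_prod, finrank_euc_clm, finrank_euc_clm, finrank_euc_clm, ← hd, mul_add])
    ).toContinuousLinearEquiv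

/-- The measure of the set of graphs over `range J₁` of maps `T Y`, `‖Y‖ ≤ 1`. -/
theorem le_haarO_of_graphPairs {r m d : ℕ} (hd : r + m = d) (J₁ : Euc r →ₗᵢ[ℝ] Euc d)
    (J₂ : Euc m →ₗᵢ[ℝ] Euc d) (horth : ∀ v w, inner ℝ (J₁ v) (J₂ w) = 0)
    (T : (Euc r →L[ℝ] Euc m) →ₗ[ℝ] (Euc r →L[ℝ] Euc m)) (hT : ∀ Y, ‖Y‖ ≤ 1 → ‖T Y‖ ≤ 1)
    (V : Gr d r) (B : Set (Gr d r))
    (hB : ∀ Y, ‖Y‖ ≤ 1 → ∀ W : Gr d r, (∀ x, x ∈ W.1 ↔ ∃ v, J₁ v + J₂ (T Y v) = x) → W ∈ B) :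
    ENNReal.ofReal ((1 / 8) ^ (r * r) * ((1 / 8) ^ (r * m) * |LinearMap.det T|)) ≤
      haarO d {U | rotate U V ∈ B} := by
  let μ₁ : Measure (Euc r →L[ℝ] Euc r) := Measure.addHaar
  let μ₂ : Measure (Euc r →L[ℝ] Euc m) := Measure.addHaar
  let Φ := glue hd J₁ J₂ horth
  let ν := (μ₁.prod μ₂).map Φ
  have hν : ν.IsAddHaarMeasure := Φ.isAddHaarMeasure_map _
  have hnorm : ∀ v w, ‖J₁ v + J₂ w‖ ^ 2 = ‖v‖ ^ 2 + ‖w‖ ^ 2 := fun v w => by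
    rw [norm_add_sq_real, horth]; simp
  have hνapp : ∀ s, ν s = (μ₁.prod μ₂) (Φ ⁻¹' s) := fun s =>
    Φ.toHomeomorph.toMeasurableEquiv.map_apply s
  have hs : MeasurableSet (Φ '' graphPairs T) :=
    ((isCompact_graphPairs T).image Φ.continuous).measurableSet
  have hs1 : Φ '' graphPairs T ⊆ Metric.closedBall 0 1 := by
    rintro _ ⟨_, ⟨⟨M, Y⟩, ⟨hM, hY⟩, rfl⟩, rfl⟩
    rw [mem_closedBall_zero_iff] at hY ⊢
    refine ContinuousLinearMap.opNorm_le_bound _ zero_le_one fun x => ?_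
    have h1 := (norm_le_of_mem_closedBall hM x).2
    have h2 := (T Y).le_of_opNorm_le (hT Y hY) (M x)
    calc ‖Φ (M, T Y ∘L M) x‖ ≤ ‖J₁ (M x)‖ + ‖J₂ (T Y (M x))‖ := norm_add_le _ _
      _ = ‖M x‖ + ‖T Y (M x)‖ := by simp
      _ ≤ 1 * ‖x‖ := by linarith
  have hrange : ∀ M ∈ Φ '' graphPairs T, ∃ W ∈ B, W.1 = LinearMap.range M.toLinearMap := by
    rintro _ ⟨_, ⟨⟨M, Y⟩, ⟨hM, hY⟩, rfl⟩, rfl⟩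
    rw [mem_closedBall_zero_iff] at hY
    have hMinj : Function.Injective M := (injective_iff_map_eq_zero M).2 fun x hx => by
      have h := (norm_le_of_mem_closedBall hM x).1
      rw [hx, norm_zero] at h
      exact norm_le_zero_iff.1 (by linarith)
    have hinj : Function.Injective (Φ (M, T Y ∘L M)).toLinearMap :=
      (injective_iff_map_eq_zero _).2 fun x hx => by
        have hn := hnorm (M x) (T Y (M x))
        have hx' : J₁ (M x) + J₂ (T Y (M x)) = 0 := hx
        rw [hx', norm_zero] at hn
        apply hMinj
        rw [map_zero, ← norm_eq_zero]
        nlinarith [norm_nonneg (M x), norm_nonneg (T Y (M x))]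
    refine ⟨⟨LinearMap.range (Φ (M, T Y ∘L M)).toLinearMap, ?_⟩, hB Y hY _ fun x => ?_, rfl⟩
    · rw [LinearMap.finrank_range_of_inj hinj, finrank_euclideanSpace_fin]
    · constructor
      · rintro ⟨u, rfl⟩
        exact ⟨M u, rfl⟩
      · rintro ⟨v, rfl⟩
        obtain ⟨u, rfl⟩ := LinearMap.injective_iff_surjective (f := M.toLinearMap).1 hMinj v
        exact ⟨u, rfl⟩
  have h := addHaar_le_haarO_mul ν V B hs hs1 hrange
  -- The glued unit ball sits inside the product of unit balls, so the unknown ball volumes cancel.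
  have hball : ν (Metric.closedBall 0 1) ≤
      μ₁ (Metric.closedBall 0 1) * μ₂ (Metric.closedBall 0 1) := by
    rw [hνapp, ← Measure.prod_prod]
    refine measure_mono fun p hp => ?_
    have hp1 : ‖Φ p‖ ≤ 1 := mem_closedBall_zero_iff.1 hp
    have hx : ∀ x, ‖p.1 x‖ ^ 2 + ‖p.2 x‖ ^ 2 ≤ (1 * ‖x‖) ^ 2 := fun x => by
      rw [← hnorm]
      exact pow_le_pow_left₀ (norm_nonneg _) ((Φ p).le_of_opNorm_le hp1 x) 2
    refine ⟨mem_closedBall_zero_iff.2 ?_, mem_closedBall_zero_iff.2 ?_⟩ <;>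
      refine ContinuousLinearMap.opNorm_le_bound _ zero_le_one fun x =>
        le_of_sq_le_sq ?_ (by positivity) <;>
      nlinarith [hx x, sq_nonneg ‖p.1 x‖, sq_nonneg ‖p.2 x‖]
  rw [hνapp, Set.preimage_image_eq _ Φ.injective] at h
  have h2 := (le_prod_graphPairs μ₁ μ₂ T).trans (h.trans (mul_le_mul_right hball _))
  refine (ENNReal.mul_le_mul_iff_left ?_ ?_).1 h2
  · exact mul_ne_zero (Metric.measure_closedBall_pos μ₁ _ one_pos).ne'
      (Metric.measure_closedBall_pos μ₂ _ one_pos).ne'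
  · exact ENNReal.mul_ne_top measure_closedBall_lt_top.ne measure_closedBall_lt_top.ne

/-! ### Graphs adapted to the ellipsoid -/

theorem norm_toEuclideanCLM_sqrt_sq {d : ℕ} {S : Matrix (Fin d) (Fin d) ℝ} (hS : S.PosSemidef)
    (x : Euc d) : ‖Matrix.toEuclideanCLM (n := Fin d) (𝕜 := ℝ) (CFC.sqrt S) x‖ ^ 2 =
      inner ℝ x (Matrix.toEuclideanLin S x) := by
  have hsa : IsSelfAdjoint (CFC.sqrt S) := (CFC.sqrt_nonneg S).isSelfAdjoint
  have hadj : ContinuousLinearMap.adjoint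
      (Matrix.toEuclideanCLM (n := Fin d) (𝕜 := ℝ) (CFC.sqrt S)) =
      Matrix.toEuclideanCLM (n := Fin d) (𝕜 := ℝ) (CFC.sqrt S) := by
    rw [← ContinuousLinearMap.star_eq_adjoint, ← map_star, hsa.star_eq]
  rw [← real_inner_self_eq_norm_sq]
  nth_rw 1 [← hadj]
  rw [ContinuousLinearMap.adjoint_inner_left, ← mul_apply_eq_comp, ← map_mul,
    CFC.sqrt_mul_sqrt_self S hS.nonneg]
  rfl

/-- In the diagonalising frame the squared norm is ∑ a_j γ_j² z_j², so the bound holds termwise. -/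
theorem norm_sqrt_isometry_diagOp_le {d n : ℕ} {S : Matrix (Fin d) (Fin d) ℝ}
    (hS : S.PosSemidef) (J : Euc n →ₗᵢ[ℝ] Euc d) {a : Fin n → ℝ}
    (hJ : ∀ u, inner ℝ (J u) (Matrix.toEuclideanLin S (J u)) = ∑ j, a j * u j ^ 2)
    {γ : Fin n → ℝ} {δ : ℝ} (hδ : 0 ≤ δ) (h : ∀ j, a j * γ j ^ 2 ≤ δ ^ 2) (z : Euc n) :
    ‖Matrix.toEuclideanCLM (n := Fin d) (𝕜 := ℝ) (CFC.sqrt S) (J (diagOp γ z))‖ ≤ δ * ‖z‖ := by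
  apply le_of_sq_le_sq _ (by positivity)
  rw [norm_toEuclideanCLM_sqrt_sq hS, hJ, mul_pow, EuclideanSpace.real_norm_sq_eq, Finset.mul_sum]
  refine Finset.sum_le_sum fun j _ => ?_
  rw [diagOp_apply, mul_pow, ← mul_assoc]
  exact mul_le_mul_of_nonneg_right (h j) (sq_nonneg _)

theorem exists_isometry_diagonalising_le_eigval {d r : ℕ} (hr : r ≤ d)
    {S : Matrix (Fin d) (Fin d) ℝ} (hS : S.IsHermitian) (V : Submodule ℝ (Euc d))
    (hV : finrank ℝ V = r) :
    ∃ (J : Euc r →ₗᵢ[ℝ] Euc d) (a : Fin r → ℝ), LinearMap.range J.toLinearMap = V ∧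
      (∀ u, inner ℝ (J u) (Matrix.toEuclideanLin S (J u)) = ∑ j, a j * u j ^ 2) ∧
      ∀ j, a j ≤ eigval hS (Fin.castLE hr j) := by
  have hT := Matrix.isSymmetric_toEuclideanLin_iff.mpr hS
  obtain ⟨J, a, hJV, ha, hJ⟩ := exists_isometry_diagonalising hT V hV
  exact ⟨J, a, hJV, hJ, fun j => diagonal_entry_le_eigenvalue finrank_euclideanSpace hT J ha hJ
    (hr.trans_eq (Fintype.card_fin d).symm) j⟩

/-- The factor `ε / √(max x ε²)` by which a direction with entry `x` is shrunk. -/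
def shrink (ε x : ℝ) : ℝ := ε / √(max x (ε ^ 2))

theorem shrink_pos {ε : ℝ} (hε : 0 < ε) (x : ℝ) : 0 < shrink ε x :=
  div_pos hε (Real.sqrt_pos.2 (lt_max_of_lt_right (by positivity)))

theorem shrink_sq {ε : ℝ} (hε : 0 < ε) (x : ℝ) :
    shrink ε x ^ 2 = ε ^ 2 / max x (ε ^ 2) := by
  rw [shrink, div_pow, Real.sq_sqrt (le_max_of_le_right (by positivity))]

theorem shrink_le_one {ε : ℝ} (hε : 0 < ε) (x : ℝ) : shrink ε x ≤ 1 := by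
  have h : ε ^ 2 ≤ max x (ε ^ 2) := le_max_right _ _
  refine (div_le_one (Real.sqrt_pos.2 (lt_max_of_lt_right (by positivity)))).2 ?_
  exact Real.le_sqrt_of_sq_le h

theorem mul_shrink_sq_le {ε : ℝ} (hε : 0 < ε) (x : ℝ) : x * shrink ε x ^ 2 ≤ ε ^ 2 := by
  have hpos : 0 < max x (ε ^ 2) := lt_max_of_lt_right (by positivity)
  rw [shrink_sq hε, mul_div_assoc', div_le_iff₀ hpos, mul_comm]
  exact mul_le_mul_of_nonneg_left (le_max_left _ _) (by positivity)

theorem shrink_anti {ε x y : ℝ} (hε : 0 < ε) (h : x ≤ y) : shrink ε y ≤ shrink ε x := by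
  refine div_le_div_of_nonneg_left hε.le
    (Real.sqrt_pos.2 (lt_max_of_lt_right (by positivity))) (Real.sqrt_le_sqrt ?_)
  exact max_le_max_right _ h

theorem log_shrink {ε : ℝ} (hε : 0 < ε) (x : ℝ) :
    Real.log (shrink ε x) = - (1 / 2) * Real.log (max x (ε ^ 2) / ε ^ 2) := by
  have h : Real.log (shrink ε x ^ 2) = - Real.log (max x (ε ^ 2) / ε ^ 2) := by
    rw [shrink_sq hε, ← Real.log_inv, inv_div]
  rw [Real.log_pow] at h
  push_cast at h
  linarith

theorem le_haarO_ellBall {r m d : ℕ} (hd : r + m = d) (hrm : r ≤ m) (V₀ V : Gr d r) {ε : ℝ}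
    (hε : 0 < ε) {S : Matrix (Fin d) (Fin d) ℝ} (hS : S.PosSemidef) :
    ENNReal.ofReal ((1 / 128) ^ (r * m) *
      ((∏ i : Fin m, shrink ε (eigval hS.isHermitian (Fin.castLE (by omega) i))) ^ r *
        (∏ j : Fin r, shrink ε (eigval hS.isHermitian (Fin.castLE (by omega) j))) ^ m)) ≤
      haarO d {U | rotate U V₀ ∈ ellBall S V ε} := by
  have hVp : finrank ℝ (V.1ᗮ : Submodule ℝ (Euc d)) = m := by
    have h := Submodule.finrank_add_finrank_orthogonal V.1
    have hV := V.2
    rw [finrank_euclideanSpace_fin] at h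
    omega
  obtain ⟨J₁, a, hJ₁V, hJ₁, ha⟩ :=
    exists_isometry_diagonalising_le_eigval (by omega) hS.isHermitian V.1 V.2
  obtain ⟨J₂, b, hJ₂V, hJ₂, hb⟩ :=
    exists_isometry_diagonalising_le_eigval (by omega) hS.isHermitian V.1ᗮ hVp
  have horth : ∀ v w, inner ℝ (J₁ v) (J₂ w) = 0 := fun v w =>
    (Submodule.mem_orthogonal V.1 _).1 (hJ₂V ▸ LinearMap.mem_range_self J₂.toLinearMap w) _
      (hJ₁V ▸ LinearMap.mem_range_self J₁.toLinearMap v)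
  let α : Fin r → ℝ := fun j => shrink ε (a j)
  -- A single factor 1/2 serves both X and X*, since each contains diag(β); it offsets the 2 in the
  -- graph estimate.
  let β : Fin m → ℝ := fun i => 1 / 2 * shrink ε (b i)
  have hα : ‖diagOp α‖ ≤ 1 := norm_diagOp_le zero_le_one fun j => by
    rw [abs_of_pos (shrink_pos hε _)]; exact shrink_le_one hε _
  have hβ : ‖diagOp β‖ ≤ 1 / 2 := norm_diagOp_le (by norm_num) fun i => by
    have h1 := shrink_pos hε (b i)
    have h2 := shrink_le_one hε (b i)
    rw [abs_of_pos (by positivity)]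
    simp only [β]
    linarith
  have hT : ∀ Y, ‖Y‖ ≤ 1 → ‖sandwich α β Y‖ ≤ 1 := fun Y hY => by
    rw [sandwich_apply]
    calc _ ≤ ‖diagOp β‖ * (‖Y‖ * ‖diagOp α‖) :=
          (ContinuousLinearMap.opNorm_comp_le _ _).trans
            (mul_le_mul_of_nonneg_left (ContinuousLinearMap.opNorm_comp_le _ _) (norm_nonneg _))
      _ ≤ 1 / 2 * (1 * 1) := by gcongr
      _ ≤ 1 := by norm_num
  refine le_trans (ENNReal.ofReal_le_ofReal ?_)
    (le_haarO_of_graphPairs hd J₁ J₂ horth (sandwich α β) hT V₀ (ellBall S V ε) ?_)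
  · have hpos : ∀ x, 0 < shrink ε x := shrink_pos hε
    have hdet : |LinearMap.det (sandwich α β)| = (1 / 2) ^ (r * m) *
        ((∏ i, shrink ε (b i)) ^ r * (∏ j, shrink ε (a j)) ^ m) := by
      rw [abs_of_pos]
      · simp_rw [det_sandwich, Finset.prod_mul_distrib, Finset.prod_const, Finset.card_univ,
          Fintype.card_fin, Finset.prod_pow, α, β, Finset.prod_mul_distrib, Finset.prod_const,
          Finset.card_univ, Fintype.card_fin, mul_pow, ← pow_mul, mul_comm m r]
        ring
      · rw [det_sandwich]
        exact Finset.prod_pos fun i _ => Finset.prod_pos fun j _ =>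
          mul_pos (mul_pos (by norm_num) (hpos _)) (hpos _)
    rw [hdet]
    -- 128 = 8 · 8 · 2: the volume of the M-ball, composition with M, and the halving in β.
    have h128 : (1 / 128 : ℝ) ^ (r * m) =
        (1 / 8) ^ (r * m) * ((1 / 8) ^ (r * m) * (1 / 2) ^ (r * m)) := by
      rw [← mul_pow, ← mul_pow]; norm_num
    -- The only use of r ≤ m.
    have h8 : (1 / 8 : ℝ) ^ (r * m) ≤ (1 / 8) ^ (r * r) :=
      pow_le_pow_of_le_one (by norm_num) (by norm_num) (Nat.mul_le_mul_left r hrm)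
    have hmono : ∀ {x x' y y' : ℝ}, 0 ≤ x → x ≤ x' → 0 ≤ y → y ≤ y' →
        (1 / 8 : ℝ) ^ (r * m) * ((1 / 8) ^ (r * m) * ((1 / 2) ^ (r * m) * (x ^ r * y ^ m))) ≤
        (1 / 8) ^ (r * r) * ((1 / 8) ^ (r * m) * ((1 / 2) ^ (r * m) * (x' ^ r * y' ^ m))) := by
      intro x x' y y' hx hxx' hy hyy'
      have hx' := hx.trans hxx'
      gcongr
    rw [h128, mul_assoc, mul_assoc]
    exact hmono (Finset.prod_nonneg fun _ _ => (hpos _).le)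
      (Finset.prod_le_prod (fun _ _ => (hpos _).le) fun i _ => shrink_anti hε (hb i))
      (Finset.prod_nonneg fun _ _ => (hpos _).le)
      (Finset.prod_le_prod (fun _ _ => (hpos _).le) fun j _ => shrink_anti hε (ha j))
  · intro Y hY W hW
    have hδ : 2 * (ε / 2) = ε := by ring
    have hX := norm_comp_starProjection_sub_graph_le J₁ J₂ hJ₁V hJ₂V (sandwich α β Y) hW
      (Matrix.toEuclideanCLM (n := Fin d) (𝕜 := ℝ) (CFC.sqrt S)) (δ := ε / 2) (by positivity)
      (fun v => ?_) (fun w => ?_)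
    · rw [hδ] at hX
      exact hX
    · refine (norm_sqrt_isometry_diagOp_le hS J₂ hJ₂ (δ := ε / 2) (by positivity) (fun i => ?_)
        (Y (diagOp α v))).trans ?_
      · have := mul_shrink_sq_le hε (b i)
        simp only [β]
        nlinarith
      · gcongr
        calc ‖Y (diagOp α v)‖ ≤ 1 * ‖diagOp α v‖ := Y.le_of_opNorm_le hY _
          _ ≤ 1 * (1 * ‖v‖) := by gcongr; exact (diagOp α).le_of_opNorm_le hα v
          _ = ‖v‖ := by ring
    · rw [sandwich_apply, ContinuousLinearMap.adjoint_comp, ContinuousLinearMap.adjoint_comp,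
        adjoint_diagOp, adjoint_diagOp]
      refine (norm_sqrt_isometry_diagOp_le hS J₁ hJ₁ (δ := ε) hε.le
        (fun j => mul_shrink_sq_le hε (a j))
        (ContinuousLinearMap.adjoint Y (diagOp β w))).trans ?_
      have hY' : ‖ContinuousLinearMap.adjoint Y‖ ≤ 1 := by
        rw [LinearIsometryEquiv.norm_map]; exact hY
      calc ε * ‖ContinuousLinearMap.adjoint Y (diagOp β w)‖
          ≤ ε * (1 * ‖diagOp β w‖) := by
            gcongr; exact (ContinuousLinearMap.adjoint Y).le_of_opNorm_le hY' _
        _ ≤ ε * (1 * (1 / 2 * ‖w‖)) := by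
            gcongr; exact (diagOp β).le_of_opNorm_le hβ w
        _ = ε / 2 * ‖w‖ := by ring

/-! ### Duality and conclusion -/

/-- The orthogonal complement, as a map between Grassmannians. -/
def compl {d r m : ℕ} (hd : r + m = d) (V : Gr d r) : Gr d m :=
  ⟨V.1ᗮ, by
    have h := Submodule.finrank_add_finrank_orthogonal V.1
    have hV := V.2
    rw [finrank_euclideanSpace_fin] at h
    omega⟩

theorem proj_compl {d r m : ℕ} (hd : r + m = d) (V : Gr d r) : proj (compl hd V) = 1 - proj V :=
  Submodule.starProjection_orthogonal' V.1

/-- Replacing P by 1 - P only changes the sign of a difference of projectors. -/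
theorem rotate_compl_mem_ellBall {d r m : ℕ} (hd : r + m = d) (V₀ V : Gr d r) (ε : ℝ)
    (S : Matrix (Fin d) (Fin d) ℝ) (U : OGroup d) :
    rotate U (compl hd V₀) ∈ ellBall S (compl hd V) ε ↔ rotate U V₀ ∈ ellBall S V ε := by
  have h : proj (compl hd V) - proj (rotate U (compl hd V₀)) =
      -(proj V - proj (rotate U V₀)) := by
    rw [proj_rotate, proj_rotate, proj_compl, proj_compl, mul_sub, sub_mul, mul_one,
      Unitary.mul_star_self_of_mem U.2]
    abel
  change ellDist _ _ _ ≤ ε ↔ ellDist _ _ _ ≤ ε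
  rw [ellDist, h, ContinuousLinearMap.comp_neg, norm_neg, ellDist]

theorem le_uniformGr_ellBall {r d : ℕ} (hr : r ≤ d) (V : Gr d r) {ε : ℝ}
    (hε : 0 < ε) {S : Matrix (Fin d) (Fin d) ℝ} (hS : S.PosSemidef) :
    (1 / 128) ^ (r * (d - r)) *
      ((∏ i : Fin (d - r), shrink ε (eigval hS.isHermitian (Fin.castLE (Nat.sub_le d r) i))) ^ r *
        (∏ j : Fin r, shrink ε (eigval hS.isHermitian (Fin.castLE hr j))) ^ (d - r)) ≤
      (uniformGr hr).real (ellBall S V ε) := by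
  have hmeas : MeasurableSet (ellBall S V ε) := by
    refine ⟨{P | ‖Matrix.toEuclideanCLM (n := Fin d) (𝕜 := ℝ) (CFC.sqrt S) ∘L (proj V - P)‖ ≤ ε},
      ?_, rfl⟩
    exact (isClosed_le (by fun_prop) continuous_const).measurableSet
  have hd : r + (d - r) = d := by omega
  have happ : uniformGr hr (ellBall S V ε) =
      haarO d {U | rotate U (coordSubspace hr) ∈ ellBall S V ε} := by
    rw [uniformGr, Measure.map_apply (measurable_rotate _) hmeas]
    rfl
  rw [Measure.real, happ, ← ENNReal.ofReal_le_iff_le_toReal (measure_ne_top _ _)]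
  rcases le_total r (d - r) with h | h
  · exact le_haarO_ellBall hd h (coordSubspace hr) V hε hS
  -- The lower bound is symmetric under exchanging r and d - r.
  · simp_rw [← rotate_compl_mem_ellBall hd]
    have := le_haarO_ellBall (by omega) h (compl hd (coordSubspace hr)) (compl hd V) hε hS
    rwa [mul_comm (d - r) r, mul_comm ((∏ _ : Fin r, _) ^ _)] at this

end GrassmannCover

end

theorem mainTheorem5 :
    ∃ C : ℝ, 0 < C ∧
      ∀ (d r : ℕ) (hr : r ≤ d) (V : GrassmannCover.Gr d r) (ε : ℝ), 0 < ε →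
        ∀ (S : Matrix (Fin d) (Fin d) ℝ) (hS : S.PosSemidef),
          0 < (GrassmannCover.uniformGr hr).real (GrassmannCover.ellBall S V ε) ∧
          Real.log (1 / (GrassmannCover.uniformGr hr).real (GrassmannCover.ellBall S V ε)) ≤
            ((d : ℝ) - (r : ℝ)) / 2 *
                ∑ k : Fin r,
                  Real.log (C * max (GrassmannCover.eigval hS.isHermitian (Fin.castLE hr k))
                    (ε ^ 2) / ε ^ 2) +
              (r : ℝ) / 2 *
                ∑ k : Fin (d - r),
                  Real.log (C * max (GrassmannCover.eigval hS.isHermitian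
                    (Fin.castLE (Nat.sub_le d r) k)) (ε ^ 2) / ε ^ 2) := by
  refine ⟨128, by norm_num, fun d r hr V ε hε S hS => ?_⟩
  have hle := GrassmannCover.le_uniformGr_ellBall hr V hε hS
  have hpos : ∀ x, 0 < GrassmannCover.shrink ε x := GrassmannCover.shrink_pos hε
  have hB := Finset.prod_pos fun (i : Fin (d - r)) (_ : i ∈ Finset.univ) =>
    hpos (GrassmannCover.eigval hS.isHermitian (Fin.castLE (Nat.sub_le d r) i))
  have hA := Finset.prod_pos fun (j : Fin r) (_ : j ∈ Finset.univ) =>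
    hpos (GrassmannCover.eigval hS.isHermitian (Fin.castLE hr j))
  have h128 : (0 : ℝ) < (1 / 128) ^ (r * (d - r)) := by positivity
  have hlow := mul_pos h128 (mul_pos (pow_pos hB r) (pow_pos hA (d - r)))
  refine ⟨hlow.trans_le hle, ?_⟩
  have hlog := Real.log_le_log hlow hle
  rw [Real.log_mul h128.ne' (by positivity), Real.log_mul (by positivity) (by positivity),
    Real.log_pow, Real.log_pow, Real.log_pow, Real.log_prod fun i _ => (hpos _).ne',
    Real.log_prod fun i _ => (hpos _).ne'] at hlog
  simp_rw [GrassmannCover.log_shrink hε, ← Finset.mul_sum] at hlog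
  -- The total r(d - r) log 128 is shared equally by the two sums, so C = 128 suffices.
  have hsplit : ∀ x, Real.log (128 * max x (ε ^ 2) / ε ^ 2) =
      Real.log 128 + Real.log (max x (ε ^ 2) / ε ^ 2) := fun x => by
    have hm : 0 < max x (ε ^ 2) := lt_max_of_lt_right (by positivity)
    rw [mul_div_assoc, Real.log_mul (by norm_num) (by positivity)]
  have hinv : Real.log (1 / 128) = - Real.log 128 := by rw [one_div, Real.log_inv]
  simp_rw [hsplit, Finset.sum_add_distrib, Finset.sum_const, Finset.card_univ, Fintype.card_fin,
    nsmul_eq_mul]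
  rw [hinv] at hlog
  push_cast [Nat.cast_sub hr] at hlog ⊢
  rw [one_div, Real.log_inv]
  linarith
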